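/- Let $\mathcal B$ be a unital C$^*$-algebra and let $\mathcal B\langle X\rangle$ be the unital $*$-algebra of noncommutative polynomials over $\mathcal B$ in a self-adjoint variable $X$ that is algebraically free from $\mathcal B$; it is the linear span of the monomials $b_1Xb_2\cdots Xb_{n+1}$ with $n\ge 0$ and $b_i\in\mathcal B$, and $(b_1Xb_2\cdots Xb_{n+1})^*=b_{n+1}^*X\cdots b_2^*Xb_1^*$. Let $\Sigma_0$ be the set of all linear maps $\mu:\mathcal B\langle X\rangle\to\mathcal B$ such that (1) $\mu$ is unital, $\mu(1)=1$, and positive, $\mu(P^*P)\ge 0$ for all $P\in\mathcal B\langle X\rangle$; (2) $\mu$ is $\mathcal B$-bimodular: $\mu(bPb')=b\,\mu(P)\,b'$ for all $b,b'\in\mathcal B$ and $P\in\mathcal B\langle X\rangle$; (3) for all $n\in\mathbb N$ and $P_1,\dots,P_n\in\mathcal B\langle X\rangle$, the matrix $[\mu(P_i^*P_j)]_{i,j=1}^n$ is positive in $M_n(\mathcal B)$; (4) there is $M>0$ such that $\|\mu(b_1Xb_2\cdots Xb_{n+1})\|\le\|b_1\|\cdots\|b_{n+1}\|\,M^n$ for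 all $n\ge 0$ and $b_1,\dots,b_{n+1}\in\mathcal B$. Then condition (2) may be weakened to $\mu|_{\mathcal B}=\mathrm{Id}$: a linear map $\mu:\mathcal B\langle X\rangle\to\mathcal B$ belongs to $\Sigma_0$ if and only if it satisfies (1), (3), (4) and $\mu(b)=b$ for all $b\in\mathcal B$. In particular, every such map is automatically $\mathcal B$-bimodular. -/

import Mathlib

/-!
The `*`-algebra `B⟨X⟩` of noncommutative polynomials in a self-adjoint variable `X` with
coefficients in a unital C*-algebra `B`, and the set of exponentially bounded `B`-valued
distributions on it.
-/

namespace OpValued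

section NCPoly

variable (B : Type*) [CStarAlgebra B]

/-- The relations presenting `B⟨X⟩`. The free algebra has one generator `some b` for each
`b : B` and one further generator `none`, which stands for `X`. The relations say exactly that
`b ↦ some b` is a homomorphism of unital complex algebras; `X` is subject to no relation. -/
inductive NCPolyRel : FreeAlgebra ℂ (Option B) → FreeAlgebra ℂ (Option B) → Prop
  | add (a b : B) : NCPolyRel (FreeAlgebra.ι ℂ (some (a + b)))
      (FreeAlgebra.ι ℂ (some a) + FreeAlgebra.ι ℂ (some b))
  | mul (a b : B) : NCPolyRel (FreeAlgebra.ι ℂ (some (a * b)))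
      (FreeAlgebra.ι ℂ (some a) * FreeAlgebra.ι ℂ (some b))
  | scalar (c : ℂ) : NCPolyRel (FreeAlgebra.ι ℂ (some (algebraMap ℂ B c)))
      (algebraMap ℂ (FreeAlgebra ℂ (Option B)) c)

/-- The algebra `B⟨X⟩`: the unital complex algebra freely generated by the algebra `B` and a
variable `X`, that is, the free product of `B` and `ℂ[X]` over `ℂ`. -/
def NCPoly : Type _ := RingQuot (NCPolyRel B)

noncomputable instance : Ring (NCPoly B) := inferInstanceAs (Ring (RingQuot (NCPolyRel B)))

noncomputable instance : Algebra ℂ (NCPoly B) :=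
  inferInstanceAs (Algebra ℂ (RingQuot (NCPolyRel B)))

namespace NCPoly

/-- The quotient map from the free algebra. -/
noncomputable def mk : FreeAlgebra ℂ (Option B) →ₐ[ℂ] NCPoly B :=
  RingQuot.mkAlgHom ℂ (NCPolyRel B)

/-- The variable `X`. -/
noncomputable def X : NCPoly B := mk B (FreeAlgebra.ι ℂ none)

variable {B} in
theorem mk_rel {p q : FreeAlgebra ℂ (Option B)} (h : NCPolyRel B p q) : mk B p = mk B q :=
  RingQuot.mkAlgHom_rel ℂ h

/-- The inclusion of the coefficient algebra `B` as the constant polynomials. -/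
noncomputable def C : B →ₐ[ℂ] NCPoly B where
  toFun b := mk B (FreeAlgebra.ι ℂ (some b))
  map_one' := by
    have h := mk_rel (NCPolyRel.scalar (B := B) 1)
    rwa [map_one, map_one, map_one] at h
  map_zero' := by
    have h := mk_rel (NCPolyRel.scalar (B := B) 0)
    rwa [map_zero, map_zero, map_zero] at h
  map_add' a b := by rw [mk_rel (NCPolyRel.add a b), map_add]
  map_mul' a b := by rw [mk_rel (NCPolyRel.mul a b), map_mul]
  commutes' c := by rw [mk_rel (NCPolyRel.scalar c), AlgHom.commutes]

variable {B} in
/-- `B⟨X⟩` is generated by scalars, constants and `X`. -/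
theorem induction {motive : NCPoly B → Prop}
    (scalar : ∀ c : ℂ, motive (algebraMap ℂ (NCPoly B) c))
    (const : ∀ b : B, motive (C B b)) (var : motive (X B))
    (add : ∀ p q, motive p → motive q → motive (p + q))
    (mul : ∀ p q, motive p → motive q → motive (p * q)) (p : NCPoly B) : motive p := by
  obtain ⟨p, rfl⟩ := RingQuot.mkAlgHom_surjective ℂ (NCPolyRel B) p
  change motive (mk B p)
  induction p using FreeAlgebra.induction with
  | grade0 c => rw [AlgHom.commutes]; exact scalar c
  | grade1 o =>
    cases o with
    | none => exact var
    | some b => exact const b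
  | mul p q hp hq => rw [map_mul]; exact mul _ _ hp hq
  | add p q hp hq => rw [map_add]; exact add _ _ hp hq

/-- The opposite algebra of `B⟨X⟩` with conjugated scalar action. A conjugate-linear
anti-endomorphism of `B⟨X⟩` is the same as an algebra homomorphism into it. -/
def ConjOp : Type _ := (NCPoly B)ᵐᵒᵖ

noncomputable instance : Ring (ConjOp B) := inferInstanceAs (Ring (NCPoly B)ᵐᵒᵖ)

noncomputable instance : Algebra ℂ (ConjOp B) :=
  RingHom.toAlgebra' ((algebraMap ℂ (NCPoly B)ᵐᵒᵖ).comp (starRingEnd ℂ))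
    (fun c x => Algebra.commutes (A := (NCPoly B)ᵐᵒᵖ) (starRingEnd ℂ c) x)

/-- The identification of the underlying rings of `ConjOp B` and of the opposite of `B⟨X⟩`. -/
noncomputable def ConjOp.equiv : ConjOp B ≃+* (NCPoly B)ᵐᵒᵖ := RingEquiv.refl (NCPoly B)ᵐᵒᵖ

theorem ConjOp.equiv_algebraMap (c : ℂ) : ConjOp.equiv B (algebraMap ℂ (ConjOp B) c) =
    MulOpposite.op (algebraMap ℂ (NCPoly B) (star c)) := rfl

/-- The values of the involution on the generators: `b ↦ b*` and `X ↦ X`. -/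
noncomputable def starGen : Option B → ConjOp B
  | none => (ConjOp.equiv B).symm (MulOpposite.op (X B))
  | some b => (ConjOp.equiv B).symm (MulOpposite.op (C B (star b)))

/-- The involution of `B⟨X⟩`, as a homomorphism into `ConjOp B`. -/
noncomputable def starHom : NCPoly B →ₐ[ℂ] ConjOp B :=
  RingQuot.liftAlgHom ℂ ⟨FreeAlgebra.lift ℂ (starGen B), by
    intro p q h
    apply (ConjOp.equiv B).injective
    cases h with
    | add a b => simp [starGen]
    | mul a b => simp [starGen]
    | scalar c =>
      rw [AlgHom.commutes, ConjOp.equiv_algebraMap]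
      simp only [FreeAlgebra.lift_ι_apply, starGen, RingEquiv.apply_symm_apply]
      rw [← algebraMap_star_comm, AlgHom.commutes]⟩

/-- The involution: `(b₁ X b₂ ⋯ X bₙ₊₁)* = bₙ₊₁* X ⋯ b₂* X b₁*`, extended conjugate-linearly. -/
noncomputable instance : Star (NCPoly B) where
  star p := (ConjOp.equiv B (starHom B p)).unop

theorem star_def (p : NCPoly B) : star p = (ConjOp.equiv B (starHom B p)).unop := rfl

theorem star_algebraMap' (c : ℂ) :
    star (algebraMap ℂ (NCPoly B) c) = algebraMap ℂ (NCPoly B) (star c) := by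
  rw [star_def, AlgHom.commutes, ConjOp.equiv_algebraMap, MulOpposite.unop_op]

theorem star_X : star (X B) = X B := by
  rw [star_def]
  have h : starHom B (X B) = FreeAlgebra.lift ℂ (starGen B) (FreeAlgebra.ι ℂ none) :=
    RingQuot.liftAlgHom_mkAlgHom_apply ..
  rw [h]
  simp [starGen]

theorem star_C (b : B) : star (C B b) = C B (star b) := by
  rw [star_def]
  have h : starHom B (C B b) = FreeAlgebra.lift ℂ (starGen B) (FreeAlgebra.ι ℂ (some b)) :=
    RingQuot.liftAlgHom_mkAlgHom_apply ..
  rw [h]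
  simp [starGen]

theorem star_add' (p q : NCPoly B) : star (p + q) = star p + star q := by
  simp [star_def]

theorem star_mul' (p q : NCPoly B) : star (p * q) = star q * star p := by
  simp [star_def]

noncomputable instance : StarRing (NCPoly B) where
  star_involutive p := by
    induction p using NCPoly.induction with
    | scalar c => rw [star_algebraMap', star_algebraMap', star_star]
    | const b => rw [star_C, star_C, star_star]
    | var => rw [star_X, star_X]
    | add p q hp hq => rw [star_add', star_add', hp, hq]
    | mul p q hp hq => rw [star_mul', star_mul', hp, hq]
  star_mul := star_mul' B
  star_add := star_add' B

instance : StarModule ℂ (NCPoly B) where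
  star_smul c p := by
    rw [Algebra.smul_def, star_mul, star_algebraMap', Algebra.smul_def, Algebra.commutes]

variable {B} in
/-- The monomial `b₀ X b₁ X b₂ ⋯ X bₙ`, of degree `n` in `X`. -/
noncomputable def monomial {n : ℕ} (b : Fin (n + 1) → B) : NCPoly B :=
  C B (b 0) * (List.ofFn fun i : Fin n => X B * C B (b i.succ)).prod

end NCPoly

end NCPoly

section Distributions

variable {B : Type*} [CStarAlgebra B] [PartialOrder B] [StarOrderedRing B]

/-- `μ(1) = 1`. -/
def IsUnital (μ : NCPoly B →ₗ[ℂ] B) : Prop := μ 1 = 1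

/-- `μ` is positive: `μ(P* P) ≥ 0` for every `P`. -/
def IsPositive (μ : NCPoly B →ₗ[ℂ] B) : Prop := ∀ P : NCPoly B, 0 ≤ μ (star P * P)

/-- `μ(b P b') = b μ(P) b'`. -/
def IsBimodular (μ : NCPoly B →ₗ[ℂ] B) : Prop :=
  ∀ (b b' : B) (P : NCPoly B), μ (NCPoly.C B b * P * NCPoly.C B b') = b * μ P * b'

/-- The restriction of `μ` to `B` is the identity. -/
def RestrictsToId (μ : NCPoly B →ₗ[ℂ] B) : Prop := ∀ b : B, μ (NCPoly.C B b) = b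

/-- For all `n` and `P₁, …, Pₙ` the matrix `[μ(Pᵢ* Pⱼ)]` is positive in the C*-algebra `Mₙ(B)`. -/
def IsCompletelyPositive (μ : NCPoly B →ₗ[ℂ] B) : Prop :=
  ∀ (n : ℕ) (P : Fin n → NCPoly B),
    0 ≤ CStarMatrix.ofMatrix (Matrix.of fun i j : Fin n => μ (star (P i) * P j))

/-- There is `M > 0` with `‖μ(b₀ X b₁ ⋯ X bₙ)‖ ≤ ‖b₀‖ ⋯ ‖bₙ‖ Mⁿ` for all `n` and all `bᵢ`. -/
def IsExpBounded (μ : NCPoly B →ₗ[ℂ] B) : Prop :=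
  ∃ M : ℝ, 0 < M ∧ ∀ (n : ℕ) (b : Fin (n + 1) → B),
    ‖μ (NCPoly.monomial b)‖ ≤ (∏ i, ‖b i‖) * M ^ n

variable (B) in
/-- The set `Σ` of abstract `B`-valued distributions. -/
def Sigma : Set (NCPoly B →ₗ[ℂ] B) :=
  {μ | IsUnital μ ∧ IsPositive μ ∧ IsBimodular μ ∧ IsCompletelyPositive μ}

variable (B) in
/-- The set `Σ₀` of exponentially bounded distributions. -/
def Sigma₀ : Set (NCPoly B →ₗ[ℂ] B) := {μ | μ ∈ Sigma B ∧ IsExpBounded μ}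

variable (B) in
/-- The set defined by the conditions of `Σ₀` with bimodularity replaced by the condition that
the restriction to `B` is the identity. -/
def WeakSigma₀ : Set (NCPoly B →ₗ[ℂ] B) :=
  {μ | IsUnital μ ∧ IsPositive μ ∧ RestrictsToId μ ∧ IsCompletelyPositive μ ∧ IsExpBounded μ}

end Distributions

end OpValued

namespace OpValued

/-! This is a multiplicative domain argument: since `μ` is the identity on `B`, it preserves `star b
* b`, and complete positivity then forces `μ (P * b) = μ P * b`. The defect `D` of this identity
appears only in the cross terms of a positive quadratic form whose constant term vanishes, so
scaling the free coefficient gives `D = 0` (`map_mul_C`). Taking adjoints gives the left-handed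
identity. Exponential boundedness plays no role and is carried along unchanged. -/

/-- A positive matrix over a C*-algebra defines a positive quadratic form. -/
theorem sum_star_mul_mul_nonneg {A n : Type*} [CStarAlgebra A] [PartialOrder A]
    [StarOrderedRing A] [Fintype n] {M : CStarMatrix n n A} (hM : 0 ≤ M) (v : n → A) :
    0 ≤ ∑ i, ∑ j, star (v i) * M i j * v j := by
  rw [StarOrderedRing.nonneg_iff] at hM
  induction hM using AddSubmonoid.closure_induction with
  | mem M hM =>
    obtain ⟨N, rfl⟩ := hM
    have h : ∑ i, ∑ j, star (v i) * (star N * N) i j * v j =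
        ∑ k, star (∑ i, N k i * v i) * ∑ j, N k j * v j := by
      simp only [CStarMatrix.mul_apply, CStarMatrix.star_apply, star_sum, star_mul,
        Finset.sum_mul, Finset.mul_sum, mul_assoc]
      rw [Finset.sum_comm]
      refine (Finset.sum_congr rfl fun _ _ => Finset.sum_comm).trans ?_
      rw [Finset.sum_comm]
    rw [h]
    exact Finset.sum_nonneg fun k _ => star_mul_self_nonneg _
  | zero => simp
  | add M N _ _ hM hN =>
    simp only [CStarMatrix.add_apply, mul_add, add_mul, Finset.sum_add_distrib]
    exact add_nonneg hM hN

/-- A positive element `H` with `t H ≤ t² K` for all `t > 0` vanishes. -/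
theorem eq_zero_of_forall_smul_le {A : Type*} [CStarAlgebra A] [PartialOrder A]
    [StarOrderedRing A] {H K : A} (hH : 0 ≤ H) (h : ∀ t : ℝ, 0 < t → t • H ≤ (t * t) • K) :
    H = 0 := by
  by_contra hne
  have hpos : 0 < ‖H‖ := norm_pos_iff.mpr hne
  have hbound (t : ℝ) (ht : 0 < t) : ‖H‖ ≤ t * ‖K‖ := by
    have := CStarAlgebra.norm_le_norm_of_nonneg_of_le (smul_nonneg ht.le hH) (h t ht)
    rw [norm_smul, norm_smul, Real.norm_of_nonneg ht.le, Real.norm_of_nonneg (by positivity),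
      mul_assoc] at this
    exact le_of_mul_le_mul_left this ht
  have hK : 0 < ‖K‖ + 1 := by positivity
  -- With this `t` the bound reads `‖H‖ * (‖K‖ + 1) ≤ ‖H‖ * ‖K‖`; the `+ 1` covers `K = 0`.
  have := hbound (‖H‖ / (‖K‖ + 1)) (by positivity)
  rw [div_mul_eq_mul_div, le_div_iff₀ hK] at this
  linarith

theorem IsBimodular.restrictsToId {B : Type*} [CStarAlgebra B] {μ : NCPoly B →ₗ[ℂ] B} (h : IsBimodular μ)
    (h1 : IsUnital μ) : RestrictsToId μ := fun b => by
  have := h b 1 1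
  rwa [map_one, mul_one, mul_one, h1, mul_one, mul_one] at this

variable {B : Type*} [CStarAlgebra B] [PartialOrder B] [StarOrderedRing B]

/-- The Gram matrix of `P` and `1` is self-adjoint; compare its off-diagonal entries. -/
theorem IsCompletelyPositive.map_star {μ : NCPoly B →ₗ[ℂ] B} (h : IsCompletelyPositive μ)
    (P : NCPoly B) : μ (star P) = star (μ P) := by
  have hs := (h 2 ![P, 1]).isSelfAdjoint.star_eq
  have := congrFun (congrFun hs 0) 1
  simpa [CStarMatrix.star_apply] using this.symm

/-- `B` lies in the right multiplicative domain of `μ`. -/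
theorem IsCompletelyPositive.map_mul_C {μ : NCPoly B →ₗ[ℂ] B} (h : IsCompletelyPositive μ)
    (hid : RestrictsToId μ) (P : NCPoly B) (b : B) :
    μ (P * NCPoly.C B b) = μ P * b := by
  have h1 : μ 1 = 1 := by rw [← map_one (NCPoly.C B), hid]
  rw [← sub_eq_zero]
  set D := μ (P * NCPoly.C B b) - μ P * b with hD
  suffices hDD : star D * D = 0 from CStarRing.star_mul_self_eq_zero_iff D |>.mp hDD
  have hstar : μ (NCPoly.C B (star b) * star P) = star (μ (P * NCPoly.C B b)) := by
    rw [← h.map_star, star_mul, NCPoly.star_C]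
  have hbb : μ (NCPoly.C B (star b) * NCPoly.C B b) = star b * b := by
    rw [← map_mul, hid]
  have hform (a : B) : 0 ≤ star a * μ (P * star P) * a + star a * D + star D * a := by
    -- The coefficients `1` and `-b` make the block of `C b` and `1` contribute `star b * b` four
    -- times with cancelling signs, because `μ` fixes `B`. The cross terms with `star P` assemble
    -- into `D`.
    have := sum_star_mul_mul_nonneg (h 3 ![star P, NCPoly.C B b, 1]) ![a, 1, -b]
    simp only [Fin.sum_univ_three, CStarMatrix.ofMatrix_apply, Matrix.of_apply,
      Matrix.cons_val_zero, Matrix.cons_val_one, Matrix.cons_val, star_star, NCPoly.star_C,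
      star_one, mul_one, one_mul, h1, hstar, hbb, h.map_star, hid b] at this
    convert this using 1
    rw [hD, star_sub, star_mul, star_neg]
    noncomm_ring
  refine eq_zero_of_forall_smul_le (K := star D * μ (P * star P) * D)
    (star_mul_self_nonneg D) fun t ht => ?_
  have hle : t • (star D * D) + t • (star D * D) ≤
      (t * t) • (star D * μ (P * star P) * D) := by
    -- This choice of `a` makes both linear terms equal to `-t • (star D * D)`, while the quadratic
    -- term scales as `t * t`.
    have := hform (-(t • D))
    rw [← sub_nonneg]
    convert this using 1
    simp only [star_neg, star_smul, star_trivial, neg_mul, mul_neg, smul_mul_assoc,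
      mul_smul_comm, neg_neg, smul_neg, mul_smul]
    abel
  exact (le_add_of_nonneg_right (smul_nonneg ht.le (star_mul_self_nonneg D))).trans hle

theorem IsCompletelyPositive.isBimodular {μ : NCPoly B →ₗ[ℂ] B} (h : IsCompletelyPositive μ)
    (hid : RestrictsToId μ) : IsBimodular μ := fun b b' P => by
  -- The adjoint of right modularity, applied to `star P` and `star b`.
  have hleft : μ (NCPoly.C B b * P) = b * μ P := by
    rw [← star_star (NCPoly.C B b * P), h.map_star, star_mul, NCPoly.star_C,
      h.map_mul_C hid, h.map_star, star_mul, star_star, star_star]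
  rw [h.map_mul_C hid, hleft]

end OpValued

theorem proposition2p7 (B : Type*) [CStarAlgebra B] [PartialOrder B] [StarOrderedRing B] :
    OpValued.WeakSigma₀ B = OpValued.Sigma₀ B := by
  ext μ
  constructor
  · rintro ⟨h1, hpos, hid, hcp, hexp⟩
    exact ⟨⟨h1, hpos, hcp.isBimodular hid, hcp⟩, hexp⟩
  · rintro ⟨⟨h1, hpos, hbi, hcp⟩, hexp⟩
    exact ⟨h1, hpos, hbi.restrictsToId h1, hcp, hexp⟩
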